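/- Let $p\ge 1$, and put $$j=\begin{bmatrix} I_p&0\\0&-I_p\end{bmatrix},\qquad J=\begin{bmatrix}0&I_p\\I_p&0\end{bmatrix},\qquad K=\frac1{\sqrt2}\begin{bmatrix}I_p&-I_p\\I_p&I_p\end{bmatrix},\qquad \mathbb C_-=\{\lambda\in\mathbb C:\ \operatorname{Im}\lambda<0\}.$$ A discrete Dirac system on $0\le k\le M$ is a recursion $$W_{k+1}(\lambda)-W_k(\lambda)=-\frac{i}{\lambda}\,jC_kW_k(\lambda)\qquad(0\le k\le M),\qquad W_0(\lambda)=I_{2p},$$ whose potentials $C_k$ ($2p\times 2p$ complex matrices) satisfy $$C_k=2K^*\beta(k)^*\beta(k)K-j,\qquad \beta(k)J\beta(k)^*=I_p\qquad(0\le k\le M)\tag{1}$$ for some $p\times 2p$ matrices $\beta(k)$. Put $\mathcal W(\lambda)=KW_{M+1}(\overline\lambda)^*$, with $p\times p$ blocks $\mathcal W_{ab}(\lambda)$, $a,b\in\{1,2\}$. A $p\times p$ matrix function $\varphi$ holomorphic in $\mathbb C_-$ is called a Weyl function of the system (on $0\le k\le M$) if, as a meromorphic function in $\mathbb C_-$,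 $$\varphi(\lambda)=i\big(\mathcal W_{21}(\lambda)R(\lambda)+\mathcal W_{22}(\lambda)Q(\lambda)\big)\big(\mathcal W_{11}(\lambda)R(\lambda)+\mathcal W_{12}(\lambda)Q(\lambda)\big)^{-1}$$ for some $p\times p$ matrix functions $R,Q$ that are meromorphic in $\mathbb C_-$, analytic at $\lambda=-i$, and satisfy $$R(\lambda)^*R(\lambda)+Q(\lambda)^*Q(\lambda)>0,\qquad R(\lambda)^*R(\lambda)\le Q(\lambda)^*Q(\lambda)$$ at $\lambda=-i$ and at all $\lambda\in\mathbb C_-$ outside a discrete set. **Theorem (Borg–Marchenko type).** Let $\widetilde\varphi$ and $\widehat\varphi$ be Weyl functions of two discrete Dirac systems satisfying (1), with the same $p$: the first with potentials $\widetilde C_k$ $(0\le k\le\widetilde N)$, the second with potentials $\widehat C_k$ $(0\le k\le\widehat N)$. Let $\{\widetilde\alpha_k\}_{k\ge0}$ and $\{\widehat\alpha_k\}_{k\ge0}$ be the Taylor coefficients at $z=0$ of $$i\,\widetilde\varphi\Big(i\,\frac{z+1}{z-1}\Big)\qquad\text{and}\qquad i\,\widehat\varphi\Big(i\,\frac{z+1}{z-1}\Big),$$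 respectively, and assume that $\widetilde\alpha_k=\widehat\alpha_k$ for all $0\le k\le N$, where $N\le\min\{\widetilde N,\widehat N\}$. Then $\widetilde C_k=\widehat C_k$ for all $0\le k\le N$. -/

import Mathlib

namespace DiscreteDirac

noncomputable section

open scoped ComplexOrder

/-- `2p × 2p` complex matrices, written in `p × p` blocks. -/
abbrev BlockMat (p : ℕ) : Type := Matrix (Fin p ⊕ Fin p) (Fin p ⊕ Fin p) ℂ

/-- `j = diag (I_p, -I_p)`. -/
def jMat (p : ℕ) : BlockMat p := Matrix.fromBlocks 1 0 0 (-1)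

/-- `J = [[0, I_p], [I_p, 0]]`. -/
def JMat (p : ℕ) : BlockMat p := Matrix.fromBlocks 0 1 1 0

/-- The unitary matrix `K = (1/√2) [[I_p, -I_p], [I_p, I_p]]`. -/
def KMat (p : ℕ) : BlockMat p :=
  ((1 / Real.sqrt 2 : ℝ) : ℂ) • Matrix.fromBlocks 1 (-1) 1 1

/-- The conditions on the potentials `C_k` of a discrete Dirac system on `0 ≤ k ≤ N`:
`C_k = 2 K* β(k)* β(k) K - j` with `p × 2p` matrices `β(k)` such that `β(k) J β(k)* = I_p`.
(The values of `C` beyond `N` are irrelevant.) -/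
def IsPotential {p : ℕ} (N : ℕ) (C : ℕ → BlockMat p) : Prop :=
  ∃ β : ℕ → Matrix (Fin p) (Fin p ⊕ Fin p) ℂ, ∀ k ≤ N,
    C k = (2 : ℂ) • ((KMat p).conjTranspose * (β k).conjTranspose * β k * KMat p) - jMat p ∧
    β k * JMat p * (β k).conjTranspose = 1

/-- The fundamental solution normalized by `W_0(μ) = I` of the discrete Dirac system
`W_{k+1}(μ) - W_k(μ) = -(i/μ) j C_k W_k(μ)`. -/
def fundSol {p : ℕ} (C : ℕ → BlockMat p) (μ : ℂ) : ℕ → BlockMat p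
  | 0 => 1
  | k + 1 => fundSol C μ k - (Complex.I / μ) • (jMat p * C k * fundSol C μ k)

/-- The coefficient matrix `𝒲(μ) = K W_{N+1}(conj μ)*` of the Möbius transformation. -/
def mobiusCoeff {p : ℕ} (C : ℕ → BlockMat p) (N : ℕ) (μ : ℂ) : BlockMat p :=
  KMat p * (fundSol C (starRingEnd ℂ μ) (N + 1)).conjTranspose

/-- The open lower half-plane. -/
def lowerHalfPlane : Set ℂ := {μ : ℂ | μ.im < 0}

/-- The inequalities `R* R + Q* Q > 0` and `R* R ≤ Q* Q`. -/
def PairIneq {p : ℕ} (R Q : Matrix (Fin p) (Fin p) ℂ) : Prop :=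
  (R.conjTranspose * R + Q.conjTranspose * Q).PosDef ∧
  (Q.conjTranspose * Q - R.conjTranspose * R).PosSemidef

/-- A pair `R`, `Q` of `p × p` matrix functions that is meromorphic in the lower half-plane,
well-defined at `-i`, and nonsingular with the `j`-property. The inequalities are required at
`-i` and at all points of the half-plane outside some discrete set (which accounts for poles,
where the value of a function is meaningless). -/
structure IsAdmissiblePair {p : ℕ} (R Q : ℂ → Matrix (Fin p) (Fin p) ℂ) : Prop where
  meromorphic_R : ∀ a b, MeromorphicOn (fun μ => R μ a b) lowerHalfPlane
  meromorphic_Q : ∀ a b, MeromorphicOn (fun μ => Q μ a b) lowerHalfPlane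
  analytic_R : ∀ a b, AnalyticAt ℂ (fun μ => R μ a b) (-Complex.I)
  analytic_Q : ∀ a b, AnalyticAt ℂ (fun μ => Q μ a b) (-Complex.I)
  ineq_at : PairIneq (R (-Complex.I)) (Q (-Complex.I))
  ineq : ∀ᶠ μ in Filter.codiscreteWithin lowerHalfPlane, PairIneq (R μ) (Q μ)

/-- `φ` is a Weyl function, on the interval `0 ≤ k ≤ N`, of the system with potentials `C_k`:
it is holomorphic in the lower half-plane and, as a meromorphic function,
`φ = i (𝒲₂₁ R + 𝒲₂₂ Q) (𝒲₁₁ R + 𝒲₁₂ Q)⁻¹` for some admissible pair `R`, `Q`. -/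
def IsWeylFunction {p : ℕ} (C : ℕ → BlockMat p) (N : ℕ)
    (φ : ℂ → Matrix (Fin p) (Fin p) ℂ) : Prop :=
  (∀ a b, DifferentiableOn ℂ (fun μ => φ μ a b) lowerHalfPlane) ∧
  ∃ R Q : ℂ → Matrix (Fin p) (Fin p) ℂ, IsAdmissiblePair R Q ∧
    ∀ᶠ μ in Filter.codiscreteWithin lowerHalfPlane,
      φ μ = Complex.I •
        (((mobiusCoeff C N μ).toBlocks₂₁ * R μ + (mobiusCoeff C N μ).toBlocks₂₂ * Q μ) *
          ((mobiusCoeff C N μ).toBlocks₁₁ * R μ + (mobiusCoeff C N μ).toBlocks₁₂ * Q μ)⁻¹)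

/-- The `k`-th Taylor coefficient (a `p × p` matrix) at `z = 0` of
`i φ (i (z + 1) / (z - 1))`. -/
def taylorCoeff {p : ℕ} (φ : ℂ → Matrix (Fin p) (Fin p) ℂ) (k : ℕ) :
    Matrix (Fin p) (Fin p) ℂ :=
  Matrix.of fun a b =>
    iteratedDeriv k
      (fun z : ℂ => Complex.I * φ (Complex.I * ((z + 1) / (z - 1))) a b) 0 / (k.factorial : ℂ)

end

end DiscreteDirac

namespace DiscreteDirac

noncomputable section

open scoped ComplexOrder
open Matrix Filter Topology

variable {p : ℕ}

/-! With `γ = β K` one has `C = (2P - 1) j`, where `P = γ* γ j` is the `j`-orthogonal projection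
onto the range of `γ*`, a strictly `j`-positive subspace whose `j`-complement `ker P` is strictly
negative. In the variable `z`, the adjoint of one step of the recursion is a scalar multiple of `1 -
P + z P`. Hence the Weyl formula says that the column space of `F_0(z) F_1(z) ⋯ X(z)`, with factors
`F_k = 1 - P_k + z P_k` and `X = (R; Q)`, is that of `(1 - iφ; -(1 + iφ))`
(`IsWeylFunction.exists_tailProd`).

Equal Taylor coefficients make two such column spaces agree modulo `z ^ (N + 1)`. At `z = 0` the
first factor is `1 - P_0`. It is injective on the `p`-dimensional nonpositive space produced by the
other factors, so its image is all of `ker P_0`, and this determines `P_0` (`jProj_eq_of_mul_eq`).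
Multiplication by `z (1 - P_0) + P_0` removes that factor at the cost of one power of `z`; induction
recovers one projection per order (`jProj_eq_of_tailProd_eq`). -/

/-- The indefinite Hermitian form `x* j x`. -/
def jForm (x : Fin p ⊕ Fin p → ℂ) : ℂ := star x ⬝ᵥ (jMat p *ᵥ x)

/-- `γ* γ j`, the `j`-orthogonal projection onto the range of `γ*` when `γ j γ* = 1`. -/
def jProj (γ : Matrix (Fin p) (Fin p ⊕ Fin p) ℂ) : BlockMat p := γᴴ * γ * jMat p

/-- The columns of `V` are a basis of a `j`-nonpositive subspace. -/
def IsJNonpos (V : Matrix (Fin p ⊕ Fin p) (Fin p) ℂ) : Prop :=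
  ∀ v, v ≠ 0 → V *ᵥ v ≠ 0 ∧ jForm (V *ᵥ v) ≤ 0

/-! ### Geometry of the `j`-form and of its orthogonal projections -/

lemma jMat_mul_jMat : jMat p * jMat p = 1 := by
  simp [jMat, fromBlocks_multiply]

lemma jMat_conjTranspose : (jMat p)ᴴ = jMat p := by
  simp [jMat, fromBlocks_conjTranspose]

lemma jForm_eq (x : Fin p ⊕ Fin p → ℂ) :
    jForm x = star (x ∘ Sum.inl) ⬝ᵥ (x ∘ Sum.inl) - star (x ∘ Sum.inr) ⬝ᵥ (x ∘ Sum.inr) := by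
  simp [jForm, jMat, fromBlocks_mulVec, dotProduct, neg_mulVec, sub_eq_add_neg]

/-- Pythagoras: `x` is `j`-orthogonal to the range of `γ*`, and `γ*` is isometric from the Euclidean
form to the `j`-form. -/
lemma jForm_conjTranspose_mulVec_add {γ : Matrix (Fin p) (Fin p ⊕ Fin p) ℂ}
    (hγ : γ * jMat p * γᴴ = 1) (u : Fin p → ℂ) {x : Fin p ⊕ Fin p → ℂ}
    (hx : γ *ᵥ (jMat p *ᵥ x) = 0) :
    jForm (γᴴ *ᵥ u + x) = star u ⬝ᵥ u + jForm x := by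
  have h1 : star (γᴴ *ᵥ u) ⬝ᵥ (jMat p *ᵥ x) = 0 := by
    rw [star_mulVec, conjTranspose_conjTranspose, ← dotProduct_mulVec, hx, dotProduct_zero]
  have h2 : star x ⬝ᵥ (jMat p *ᵥ (γᴴ *ᵥ u)) = 0 := by
    have := congrArg star hx
    rw [mulVec_mulVec, star_mulVec, conjTranspose_mul, jMat_conjTranspose, star_zero] at this
    rw [mulVec_mulVec, dotProduct_mulVec, this, zero_dotProduct]
  have h3 : star (γᴴ *ᵥ u) ⬝ᵥ (jMat p *ᵥ (γᴴ *ᵥ u)) = star u ⬝ᵥ u := by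
    rw [star_mulVec, conjTranspose_conjTranspose, ← dotProduct_mulVec, mulVec_mulVec,
      mulVec_mulVec, hγ, one_mulVec]
  simp only [jForm, star_add, mulVec_add, dotProduct_add, add_dotProduct, h1, h2, h3]
  ring

lemma eq_zero_of_jForm_conjTranspose_nonpos {γ : Matrix (Fin p) (Fin p ⊕ Fin p) ℂ}
    (hγ : γ * jMat p * γᴴ = 1) {u : Fin p → ℂ} (h : jForm (γᴴ *ᵥ u) ≤ 0) : u = 0 := by
  have := jForm_conjTranspose_mulVec_add hγ u (x := 0) (by simp)
  rw [add_zero] at this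
  rw [this] at h
  simp only [jForm, star_zero, zero_dotProduct, add_zero] at h
  exact dotProduct_star_self_eq_zero.1 (le_antisymm h (dotProduct_star_self_nonneg u))

/-- The `j`-orthogonal complement of the range of `γ*` is strictly negative. -/
lemma jForm_kernel {γ : Matrix (Fin p) (Fin p ⊕ Fin p) ℂ}
    (hγ : γ * jMat p * γᴴ = 1) {x : Fin p ⊕ Fin p → ℂ} (hx : γ *ᵥ (jMat p *ᵥ x) = 0) :
    jForm x ≤ 0 ∧ (jForm x = 0 → x = 0) := by
  have hinj : Function.Injective (γᴴ.toRows₁ *ᵥ ·) := by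
    refine (injective_iff_map_eq_zero (γᴴ.toRows₁.mulVecLin)).2 fun u hu => ?_
    apply eq_zero_of_jForm_conjTranspose_nonpos hγ
    have : (γᴴ *ᵥ u) ∘ Sum.inl = 0 := hu
    rw [jForm_eq, this]
    simp [dotProduct_star_self_nonneg]
  -- The upper block of `γ*` is invertible, so `u` can cancel the upper half of `x`. Then `γ* u + x`
  -- has nonpositive form, and Pythagoras gives `jForm x ≤ -|u|²`.
  obtain ⟨u, hu⟩ := (mulVec_surjective_iff_isUnit.2 (mulVec_injective_iff_isUnit.1 hinj))
    (-(x ∘ Sum.inl))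
  have h1 : (γᴴ *ᵥ u + x) ∘ Sum.inl = 0 := by
    have : (γᴴ *ᵥ u) ∘ Sum.inl = -(x ∘ Sum.inl) := hu
    rw [Pi.add_comp, this, neg_add_cancel]
  have h2 := jForm_conjTranspose_mulVec_add hγ u hx
  rw [jForm_eq, h1, star_zero, zero_dotProduct, zero_sub] at h2
  have h3 := dotProduct_star_self_nonneg ((γᴴ *ᵥ u + x) ∘ Sum.inr)
  have h4 := dotProduct_star_self_nonneg u
  have h5 : jForm x = -(star ((γᴴ *ᵥ u + x) ∘ Sum.inr) ⬝ᵥ ((γᴴ *ᵥ u + x) ∘ Sum.inr) +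
    star u ⬝ᵥ u) := by rw [neg_add, h2]; ring
  refine ⟨by rw [h5]; exact neg_nonpos.2 (add_nonneg h3 h4), fun h0 => ?_⟩
  rw [h5, neg_eq_zero, add_eq_zero_iff_of_nonneg h3 h4, dotProduct_star_self_eq_zero,
    dotProduct_star_self_eq_zero] at h0
  have hx0 : γᴴ *ᵥ u + x = 0 := by
    ext (i | i)
    · exact congrFun h1 i
    · exact congrFun h0.1 i
  simpa [h0.2] using hx0

lemma mul_jMat_mul_one_sub_jProj {γ : Matrix (Fin p) (Fin p ⊕ Fin p) ℂ}
    (hγ : γ * jMat p * γᴴ = 1) : γ * (jMat p * (1 - jProj γ)) = 0 := by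
  have : γ * (jMat p * (1 - jProj γ)) = γ * jMat p - (γ * jMat p * γᴴ) * γ * jMat p := by
    simp only [jProj, Matrix.mul_sub, Matrix.mul_assoc, Matrix.mul_one]
  rw [this, hγ, Matrix.one_mul, sub_self]

lemma jProj_mul_self {γ : Matrix (Fin p) (Fin p ⊕ Fin p) ℂ}
    (hγ : γ * jMat p * γᴴ = 1) : jProj γ * jProj γ = jProj γ := by
  have : jProj γ * jProj γ = γᴴ * (γ * jMat p * γᴴ) * γ * jMat p := by
    simp only [jProj, Matrix.mul_assoc]
  rw [this, hγ, Matrix.mul_one, jProj]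

lemma jMat_one_sub_jProj_mulVec {γ : Matrix (Fin p) (Fin p ⊕ Fin p) ℂ}
    (hγ : γ * jMat p * γᴴ = 1) (T : Matrix (Fin p ⊕ Fin p) (Fin p) ℂ) (v : Fin p → ℂ) :
    γ *ᵥ (jMat p *ᵥ (((1 - jProj γ) * T) *ᵥ v)) = 0 := by
  have : γ *ᵥ (jMat p *ᵥ (((1 - jProj γ) * T) *ᵥ v)) =
      (γ * (jMat p * (1 - jProj γ))) *ᵥ (T *ᵥ v) := by
    simp only [mulVec_mulVec, Matrix.mul_assoc]
  rw [this, mul_jMat_mul_one_sub_jProj hγ, zero_mulVec]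

/-- A vector killed by `1 - P` lies in the range of `γ*`, which is strictly positive and so meets a
nonpositive subspace only in `0`. -/
lemma one_sub_jProj_mul_mulVec_ne_zero {γ : Matrix (Fin p) (Fin p ⊕ Fin p) ℂ}
    (hγ : γ * jMat p * γᴴ = 1) {T : Matrix (Fin p ⊕ Fin p) (Fin p) ℂ} (hT : IsJNonpos T)
    {v : Fin p → ℂ} (hv : v ≠ 0) : ((1 - jProj γ) * T) *ᵥ v ≠ 0 := by
  intro h0
  obtain ⟨h1, h2⟩ := hT v hv
  have h3 : T *ᵥ v = γᴴ *ᵥ (γ *ᵥ (jMat p *ᵥ (T *ᵥ v))) := by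
    rw [Matrix.sub_mul, Matrix.one_mul, sub_mulVec, sub_eq_zero] at h0
    conv_lhs => rw [h0, jProj]
    simp only [mulVec_mulVec, Matrix.mul_assoc]
  have h4 := eq_zero_of_jForm_conjTranspose_nonpos hγ (h3 ▸ h2)
  exact h1 (by rw [h3, h4, mulVec_zero])

lemma IsJNonpos.one_sub_jProj_mul {γ : Matrix (Fin p) (Fin p ⊕ Fin p) ℂ}
    (hγ : γ * jMat p * γᴴ = 1) {T : Matrix (Fin p ⊕ Fin p) (Fin p) ℂ} (hT : IsJNonpos T) :
    IsJNonpos ((1 - jProj γ) * T) := fun v hv =>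
  ⟨one_sub_jProj_mul_mulVec_ne_zero hγ hT hv,
    (jForm_kernel hγ (jMat_one_sub_jProj_mulVec hγ T v)).1⟩

/-- The projection is recovered from any basis of its kernel. -/
lemma jProj_eq_one_sub {γ : Matrix (Fin p) (Fin p ⊕ Fin p) ℂ}
    (hγ : γ * jMat p * γᴴ = 1) {V : Matrix (Fin p ⊕ Fin p) (Fin p) ℂ}
    (hV : γ * (jMat p * V) = 0) (hinj : ∀ v, v ≠ 0 → V *ᵥ v ≠ 0) :
    jProj γ = 1 - V * (Vᴴ * jMat p * V)⁻¹ * Vᴴ * jMat p := by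
  have hVv (v : Fin p → ℂ) : γ *ᵥ (jMat p *ᵥ (V *ᵥ v)) = 0 := by
    simp only [mulVec_mulVec]; rw [hV, zero_mulVec]
  -- The Gram matrix is nonsingular because the form is strictly negative on the range of `V`.
  have hG : IsUnit (Vᴴ * jMat p * V) := by
    refine mulVec_injective_iff_isUnit.1
      ((injective_iff_map_eq_zero (Vᴴ * jMat p * V).mulVecLin).2 fun v hv => ?_)
    by_contra hne
    refine hinj v hne ((jForm_kernel hγ (hVv v)).2 ?_)
    have : star v ⬝ᵥ ((Vᴴ * jMat p * V) *ᵥ v) = 0 := by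
      rw [show (Vᴴ * jMat p * V) *ᵥ v = 0 from hv, dotProduct_zero]
    rwa [Matrix.mul_assoc, ← mulVec_mulVec, ← mulVec_mulVec, dotProduct_mulVec,
      ← star_mulVec] at this
  -- The columns of `V` and `γ*` together form a basis, so the identity need only be checked on
  -- them.
  have hS : IsUnit (fromCols V γᴴ) := by
    refine mulVec_injective_iff_isUnit.1
      ((injective_iff_map_eq_zero (fromCols V γᴴ).mulVecLin).2 fun v hv => ?_)
    have h0 : V *ᵥ (v ∘ Sum.inl) + γᴴ *ᵥ (v ∘ Sum.inr) = 0 := by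
      rw [← fromCols_mulVec]; exact hv
    have h1 : v ∘ Sum.inr = 0 := by
      have := congrArg (fun x => γ *ᵥ (jMat p *ᵥ x)) h0
      simp only [mulVec_add, hVv, zero_add, mulVec_zero] at this
      rwa [mulVec_mulVec, mulVec_mulVec, hγ, one_mulVec] at this
    have h2 : v ∘ Sum.inl = 0 := by
      by_contra hne
      exact hinj _ hne (by simpa [h1] using h0)
    ext (i | i)
    · exact congrFun h2 i
    · exact congrFun h1 i
  have hV' : Vᴴ * (jMat p * γᴴ) = 0 := by
    have := congrArg conjTranspose hV
    rwa [conjTranspose_mul, conjTranspose_mul, jMat_conjTranspose, conjTranspose_zero,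
      Matrix.mul_assoc] at this
  have hkey : (jProj γ + V * (Vᴴ * jMat p * V)⁻¹ * Vᴴ * jMat p) * fromCols V γᴴ
      = 1 * fromCols V γᴴ := by
    have e1 : jProj γ * V = 0 := by
      rw [jProj, Matrix.mul_assoc, Matrix.mul_assoc, hV, Matrix.mul_zero]
    have e2 : jProj γ * γᴴ = γᴴ := by
      rw [jProj, Matrix.mul_assoc, Matrix.mul_assoc, ← Matrix.mul_assoc γ, hγ, Matrix.mul_one]
    have e3 : V * (Vᴴ * jMat p * V)⁻¹ * Vᴴ * jMat p * V = V := by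
      rw [Matrix.mul_assoc, Matrix.mul_assoc, Matrix.mul_assoc, ← Matrix.mul_assoc Vᴴ,
        nonsing_inv_mul _ ((isUnit_iff_isUnit_det _).1 hG), Matrix.mul_one]
    have e4 : V * (Vᴴ * jMat p * V)⁻¹ * Vᴴ * jMat p * γᴴ = 0 := by
      rw [Matrix.mul_assoc, Matrix.mul_assoc, hV', Matrix.mul_zero]
    rw [Matrix.one_mul, mul_fromCols, Matrix.add_mul, Matrix.add_mul, e1, e2, e3, e4, zero_add,
      add_zero]
  exact eq_sub_of_add_eq (hS.mul_right_cancel hkey)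

/-- By dimension, the common column space is the whole kernel of each projection; a `j`-orthogonal
projection is determined by its kernel. -/
lemma jProj_eq_of_mul_eq {γ δ : Matrix (Fin p) (Fin p ⊕ Fin p) ℂ}
    (hγ : γ * jMat p * γᴴ = 1) (hδ : δ * jMat p * δᴴ = 1)
    {S T : Matrix (Fin p ⊕ Fin p) (Fin p) ℂ} (hS : IsJNonpos S) {U : Matrix (Fin p) (Fin p) ℂ}
    (hU : IsUnit U) (h : (1 - jProj δ) * T = (1 - jProj γ) * S * U) : jProj γ = jProj δ := by
  have hγV : γ * (jMat p * ((1 - jProj γ) * S)) = 0 := by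
    have := mul_jMat_mul_one_sub_jProj hγ
    rw [← Matrix.mul_assoc] at this
    rw [← Matrix.mul_assoc, ← Matrix.mul_assoc, this, Matrix.zero_mul]
  have hδV : δ * (jMat p * ((1 - jProj γ) * S)) = 0 := by
    have h1 : (1 - jProj γ) * S = (1 - jProj δ) * T * U⁻¹ := by
      rw [h, mul_nonsing_inv_cancel_right _ _ ((isUnit_iff_isUnit_det _).1 hU)]
    have := mul_jMat_mul_one_sub_jProj hδ
    rw [← Matrix.mul_assoc] at this
    rw [h1, ← Matrix.mul_assoc, ← Matrix.mul_assoc, ← Matrix.mul_assoc, this,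
      Matrix.zero_mul, Matrix.zero_mul]
  have hinj v (hv : v ≠ 0) := one_sub_jProj_mul_mulVec_ne_zero hγ hS hv
  rw [jProj_eq_one_sub hγ hγV hinj, jProj_eq_one_sub hδ hδV hinj]

/-! ### Products of elementary factors, removed one at a time -/

lemma continuousAt_matrix_mul {α l m n : Type*} [TopologicalSpace α] [Fintype m]
    {f : α → Matrix l m ℂ} {g : α → Matrix m n ℂ} {a : α}
    (hf : ContinuousAt f a) (hg : ContinuousAt g a) : ContinuousAt (fun x => f x * g x) a :=
  (Continuous.matrix_mul continuous_fst continuous_snd).continuousAt.comp (hf.prodMk hg)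

/-- The elementary factor `1 - P + z P` of the transfer matrix, with `P = γ* γ j`. -/
def diracFactor (γ : Matrix (Fin p) (Fin p ⊕ Fin p) ℂ) (z : ℂ) : BlockMat p :=
  1 - jProj γ + z • jProj γ

/-- The product of the `n` factors with indices `k, …, k + n - 1`, applied to `X`. -/
def tailProd (γ : ℕ → Matrix (Fin p) (Fin p ⊕ Fin p) ℂ)
    (X : ℂ → Matrix (Fin p ⊕ Fin p) (Fin p) ℂ) : ℕ → ℕ → ℂ → Matrix (Fin p ⊕ Fin p) (Fin p) ℂ
  | 0, _ => X
  | n + 1, k => fun z => diracFactor (γ k) z * tailProd γ X n (k + 1) z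

lemma diracFactor_zero (γ : Matrix (Fin p) (Fin p ⊕ Fin p) ℂ) :
    diracFactor γ 0 = 1 - jProj γ := by simp [diracFactor]

lemma continuous_diracFactor (γ : Matrix (Fin p) (Fin p ⊕ Fin p) ℂ) :
    Continuous (diracFactor γ) := by
  unfold diracFactor; fun_prop

/-- Inverts a factor up to the scalar `z`; this is why removing a factor costs exactly one order of
agreement. -/
lemma reverse_mul_diracFactor {γ : Matrix (Fin p) (Fin p ⊕ Fin p) ℂ}
    (hγ : γ * jMat p * γᴴ = 1) (z : ℂ) :
    (z • (1 - jProj γ) + jProj γ) * diracFactor γ z = z • 1 := by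
  have h := jProj_mul_self hγ
  simp only [diracFactor, add_mul, mul_add, sub_mul, mul_sub, smul_mul_assoc, mul_smul_comm, h,
    one_mul, mul_one, sub_self, smul_zero, smul_sub, smul_add]
  abel

lemma continuousAt_tailProd (γ : ℕ → Matrix (Fin p) (Fin p ⊕ Fin p) ℂ)
    {X : ℂ → Matrix (Fin p ⊕ Fin p) (Fin p) ℂ} (hX : ContinuousAt X 0) (n k : ℕ) :
    ContinuousAt (tailProd γ X n k) 0 := by
  induction n generalizing k with
  | zero => exact hX
  | succ n ih =>
    exact continuousAt_matrix_mul (continuous_diracFactor _).continuousAt (ih (k + 1))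

lemma isJNonpos_tailProd {γ : ℕ → Matrix (Fin p) (Fin p ⊕ Fin p) ℂ}
    (hγ : ∀ k, γ k * jMat p * (γ k)ᴴ = 1)
    {X : ℂ → Matrix (Fin p ⊕ Fin p) (Fin p) ℂ} (hX : IsJNonpos (X 0)) (n k : ℕ) :
    IsJNonpos (tailProd γ X n k 0) := by
  induction n generalizing k with
  | zero => exact hX
  | succ n ih =>
    simp only [tailProd, diracFactor_zero]
    exact (ih (k + 1)).one_sub_jProj_mul (hγ k)

/-- If the column spaces of two products agree to order `m` at `0`, then so do their first
`m` factors. -/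
lemma jProj_eq_of_tailProd_eq {γ δ : ℕ → Matrix (Fin p) (Fin p ⊕ Fin p) ℂ}
    (hγ : ∀ k, γ k * jMat p * (γ k)ᴴ = 1) (hδ : ∀ k, δ k * jMat p * (δ k)ᴴ = 1)
    {X Y : ℂ → Matrix (Fin p ⊕ Fin p) (Fin p) ℂ}
    (hXc : ContinuousAt X 0) (hYc : ContinuousAt Y 0) (hX : IsJNonpos (X 0))
    {U : ℂ → Matrix (Fin p) (Fin p) ℂ} (hUc : ContinuousAt U 0) (hU : IsUnit (U 0))
    (m : ℕ) : ∀ (n n' k : ℕ), m ≤ n → m ≤ n' →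
    ∀ E : ℂ → Matrix (Fin p ⊕ Fin p) (Fin p) ℂ, ContinuousAt E 0 →
    (∀ᶠ z in 𝓝[≠] 0, tailProd δ Y n' k z = tailProd γ X n k z * U z + z ^ m • E z) →
    ∀ l < m, jProj (γ (k + l)) = jProj (δ (k + l)) := by
  induction m with
  | zero => intro _ _ _ _ _ _ _ _ l hl; omega
  | succ m ih =>
    rintro (_ | n) (_ | n') k hn hn' E hE h
    · omega
    · omega
    · omega
    -- The relation holds only off `0`, so it is passed to the limit; the error vanishes there
    -- because its exponent is positive.
    have h0 : tailProd δ Y (n' + 1) k 0 = tailProd γ X (n + 1) k 0 * U 0 := by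
      have hc := continuousAt_tailProd δ hYc (n' + 1) k
      have hc' : ContinuousAt
          (fun z => tailProd γ X (n + 1) k z * U z + z ^ (m + 1) • E z) 0 :=
        (continuousAt_matrix_mul (continuousAt_tailProd γ hXc (n + 1) k) hUc).add
          ((continuousAt_id.pow _).smul hE)
      have := tendsto_nhds_unique (hc.tendsto.mono_left nhdsWithin_le_nhds)
        ((hc'.tendsto.mono_left nhdsWithin_le_nhds).congr' (h.mono fun _ hz => hz.symm))
      simpa using this
    have hk : jProj (γ k) = jProj (δ k) := by
      simp only [tailProd, diracFactor_zero] at h0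
      exact jProj_eq_of_mul_eq (hγ k) (hδ k) (isJNonpos_tailProd hγ hX n (k + 1)) hU h0
    have hstep : ∀ᶠ z in 𝓝[≠] (0 : ℂ), tailProd δ Y n' (k + 1) z =
        tailProd γ X n (k + 1) z * U z +
          z ^ m • ((z • (1 - jProj (γ k)) + jProj (γ k)) * E z) := by
      filter_upwards [h, self_mem_nhdsWithin] with z hz hz0
      have hz0 : z ≠ 0 := hz0
      have hd : diracFactor (δ k) z = diracFactor (γ k) z := by rw [diracFactor, ← hk, diracFactor]
      have := congrArg (fun A : Matrix (Fin p ⊕ Fin p) (Fin p) ℂ =>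
        (z • (1 - jProj (γ k)) + jProj (γ k)) * A) hz
      simp only [tailProd, hd, Matrix.mul_add, Matrix.mul_smul] at this
      rw [← Matrix.mul_assoc, ← Matrix.mul_assoc, ← Matrix.mul_assoc,
        reverse_mul_diracFactor (hγ k), Matrix.smul_mul, Matrix.smul_mul, Matrix.one_mul,
        Matrix.one_mul, pow_succ', mul_smul, Matrix.smul_mul, ← smul_add] at this
      exact smul_right_injective _ hz0 this
    rintro (_ | l) hl
    · exact hk
    · have := ih n n' (k + 1) (by omega) (by omega) _
        (continuousAt_matrix_mul (by fun_prop) hE) hstep l (by omega)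
      rwa [show k + (l + 1) = k + 1 + l by omega]

/-! ### From the Dirac system to products of factors -/

/-- The product of the first `n` factors. -/
def headProd (γ : ℕ → Matrix (Fin p) (Fin p ⊕ Fin p) ℂ) : ℕ → ℂ → BlockMat p
  | 0, _ => 1
  | n + 1, z => headProd γ n z * diracFactor (γ n) z

/-- The recursion appends factors on the right, whereas the induction removes them from the left;
this reconciles the two. -/
lemma headProd_mul_tailProd (γ : ℕ → Matrix (Fin p) (Fin p ⊕ Fin p) ℂ)
    (X : ℂ → Matrix (Fin p ⊕ Fin p) (Fin p) ℂ) (z : ℂ) (n k : ℕ) :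
    headProd γ k z * tailProd γ X n k z = headProd γ (k + n) z * X z := by
  induction n generalizing k with
  | zero => rfl
  | succ n ih =>
    rw [show k + (n + 1) = k + 1 + n by omega, ← ih (k + 1)]
    simp only [tailProd, headProd, Matrix.mul_assoc]

/-- The Möbius map from the unit disk to the lower half-plane. -/
def diskToHalfPlane (z : ℂ) : ℂ := Complex.I * ((z + 1) / (z - 1))

lemma diskToHalfPlane_zero : diskToHalfPlane 0 = -Complex.I := by simp [diskToHalfPlane]

lemma analyticAt_diskToHalfPlane : AnalyticAt ℂ diskToHalfPlane 0 := by
  unfold diskToHalfPlane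
  exact analyticAt_const.mul ((analyticAt_id.add analyticAt_const).div
    (analyticAt_id.sub analyticAt_const) (by simp))

lemma eventually_ne_one : ∀ᶠ z : ℂ in 𝓝 0, z - 1 ≠ 0 ∧ z + 1 ≠ 0 :=
  ((continuous_id.sub continuous_const).continuousAt.eventually_ne (by simp)).and
    ((continuous_id.add continuous_const).continuousAt.eventually_ne (by simp))

lemma tendsto_diskToHalfPlane : Tendsto diskToHalfPlane (𝓝[≠] 0) (𝓝[≠] (-Complex.I)) := by
  rw [← diskToHalfPlane_zero]
  refine tendsto_nhdsWithin_iff.2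
    ⟨analyticAt_diskToHalfPlane.continuousAt.tendsto.mono_left nhdsWithin_le_nhds, ?_⟩
  filter_upwards [self_mem_nhdsWithin, eventually_ne_one.filter_mono nhdsWithin_le_nhds]
    with z hz hz1 h
  rw [Set.mem_singleton_iff, diskToHalfPlane_zero, diskToHalfPlane] at h
  have h2 : (z + 1) / (z - 1) = -1 := mul_left_cancel₀ Complex.I_ne_zero (by rw [h]; ring)
  rw [div_eq_iff hz1.1] at h2
  have : (2 : ℂ) * z = 0 := by linear_combination h2
  exact hz (by simpa using this)

/-- Turns the normalization `β J β* = 1` into `γ j γ* = 1` for `γ = β K`. -/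
lemma KMat_mul_jMat_mul : KMat p * jMat p * (KMat p)ᴴ = JMat p := by
  have h : ((1 / Real.sqrt 2 : ℝ) : ℂ) * ((1 / Real.sqrt 2 : ℝ) : ℂ) = 1 / 2 := by
    rw [← Complex.ofReal_mul, div_mul_div_comm, one_mul, Real.mul_self_sqrt (by norm_num)]
    norm_num
  rw [KMat, conjTranspose_smul, Matrix.smul_mul, Matrix.smul_mul, Matrix.mul_smul, smul_smul,
    Complex.star_def, Complex.conj_ofReal, h]
  simp only [jMat, JMat, fromBlocks_conjTranspose, fromBlocks_multiply, fromBlocks_smul]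
  congr 1 <;> simp [← two_smul ℂ (1 : Matrix (Fin p) (Fin p) ℂ), smul_smul]

lemma IsPotential.exists_jProj {N : ℕ} {C : ℕ → BlockMat p} (hC : IsPotential N C) :
    ∃ γ : ℕ → Matrix (Fin p) (Fin p ⊕ Fin p) ℂ, (∀ k, γ k * jMat p * (γ k)ᴴ = 1) ∧
      ∀ k ≤ N, C k = ((2 : ℂ) • jProj (γ k) - 1) * jMat p := by
  obtain ⟨β, hβ⟩ := hC
  -- Freezing the index at `N` makes the normalization hold for every `k`.
  refine ⟨fun k => β (min k N) * KMat p, fun k => ?_, fun k hk => ?_⟩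
  · rw [conjTranspose_mul, ← (hβ (min k N) (min_le_right _ _)).2, ← KMat_mul_jMat_mul]
    simp only [Matrix.mul_assoc]
  · simp only [min_eq_left hk]
    rw [(hβ k hk).1, sub_mul, one_mul, smul_mul_assoc, jProj,
      Matrix.mul_assoc _ _ (jMat p),
      jMat_mul_jMat, Matrix.mul_one, conjTranspose_mul]
    simp only [Matrix.mul_assoc]

/-- With `t = (z - 1) / (z + 1)`, the factor `1 + t (2P - 1)` acts as `2 / (z + 1)` on `ker P` and
as `2z / (z + 1)` on the range of `P`. -/
lemma fundSol_conjTranspose {N : ℕ} {C : ℕ → BlockMat p}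
    {γ : ℕ → Matrix (Fin p) (Fin p ⊕ Fin p) ℂ}
    (hC : ∀ k ≤ N, C k = ((2 : ℂ) • jProj (γ k) - 1) * jMat p)
    {z : ℂ} (h1 : z - 1 ≠ 0) (h2 : z + 1 ≠ 0) (n : ℕ) (hn : n ≤ N + 1) :
    (fundSol C (starRingEnd ℂ (diskToHalfPlane z)) n)ᴴ = (2 / (z + 1)) ^ n • headProd γ n z := by
  induction n with
  | zero => simp [fundSol, headProd]
  | succ n ih =>
    have hCH : (jMat p * C n)ᴴ = (2 : ℂ) • jProj (γ n) - 1 := by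
      have e : (jProj (γ n))ᴴ = jMat p * jProj (γ n) * jMat p := by
        simp only [jProj, conjTranspose_mul, conjTranspose_conjTranspose, jMat_conjTranspose,
          Matrix.mul_assoc, jMat_mul_jMat, Matrix.mul_one]
      rw [hC n (by omega)]
      simp only [conjTranspose_mul, conjTranspose_sub, conjTranspose_smul, jMat_conjTranspose,
        conjTranspose_one, e, mul_sub, sub_mul, mul_one, Matrix.mul_smul, Matrix.smul_mul,
        jMat_mul_jMat]
      simp only [← Matrix.mul_assoc, jMat_mul_jMat, Matrix.one_mul]
      simp only [Matrix.mul_assoc, jMat_mul_jMat, Matrix.mul_one]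
      simp
    have hs : star (Complex.I / starRingEnd ℂ (diskToHalfPlane z)) = -((z - 1) / (z + 1)) := by
      simp only [Complex.star_def, map_div₀, Complex.conj_conj, Complex.conj_I, diskToHalfPlane]
      field_simp
    rw [fundSol, conjTranspose_sub, conjTranspose_smul, hs, conjTranspose_mul (jMat p * C n), hCH,
      ih (by omega), headProd, pow_succ, mul_smul, Matrix.smul_mul, smul_comm, ← smul_sub,
      neg_smul, sub_neg_eq_add]
    congr 1
    have hf : diracFactor (γ n) z =
        ((z + 1) / 2) • (1 + ((z - 1) / (z + 1)) • ((2 : ℂ) • jProj (γ n) - 1)) := by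
      rw [diracFactor]
      match_scalars <;> field_simp <;> ring
    rw [hf, Matrix.mul_smul, smul_smul, div_mul_div_comm, mul_comm (2 : ℂ),
      div_self (mul_ne_zero h2 two_ne_zero), one_smul, Matrix.mul_add, Matrix.mul_one,
      Matrix.mul_smul]

lemma toBlocks_mul_add (A : BlockMat p) (R Q : Matrix (Fin p) (Fin p) ℂ) :
    A.toBlocks₁₁ * R + A.toBlocks₁₂ * Q = (A * fromRows R Q).toRows₁ ∧
    A.toBlocks₂₁ * R + A.toBlocks₂₂ * Q = (A * fromRows R Q).toRows₂ := by
  rw [← fromBlocks_toBlocks A, fromBlocks_mul_fromRows]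
  simp

lemma KMat_mul_toRows (Y : Matrix (Fin p ⊕ Fin p) (Fin p) ℂ) :
    (KMat p * Y).toRows₁ = ((1 / Real.sqrt 2 : ℝ) : ℂ) • (Y.toRows₁ - Y.toRows₂) ∧
    (KMat p * Y).toRows₂ = ((1 / Real.sqrt 2 : ℝ) : ℂ) • (Y.toRows₁ + Y.toRows₂) := by
  have : KMat p * Y = ((1 / Real.sqrt 2 : ℝ) : ℂ) •
      fromRows (Y.toRows₁ - Y.toRows₂) (Y.toRows₁ + Y.toRows₂) := by
    conv_lhs => rw [← fromRows_toRows Y, KMat, Matrix.smul_mul, fromBlocks_mul_fromRows]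
    simp [sub_eq_add_neg]
  rw [this]
  exact ⟨rfl, rfl⟩

lemma PairIneq.isJNonpos {R Q : Matrix (Fin p) (Fin p) ℂ} (h : PairIneq R Q) :
    IsJNonpos (fromRows R Q) := by
  intro v hv
  have key (A : Matrix (Fin p) (Fin p) ℂ) : star v ⬝ᵥ ((Aᴴ * A) *ᵥ v) =
      star (A *ᵥ v) ⬝ᵥ (A *ᵥ v) := by
    rw [star_mulVec, ← mulVec_mulVec, dotProduct_mulVec]
  have h1 := h.1.dotProduct_mulVec_pos hv
  have h2 := h.2.dotProduct_mulVec_nonneg v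
  rw [add_mulVec, dotProduct_add, key, key] at h1
  rw [sub_mulVec, dotProduct_sub, key, key, sub_nonneg] at h2
  rw [fromRows_mulVec]
  refine ⟨fun h0 => h1.ne' ?_, ?_⟩
  · have hR : R *ᵥ v = 0 := funext fun i => congrFun h0 (Sum.inl i)
    have hQ : Q *ᵥ v = 0 := funext fun i => congrFun h0 (Sum.inr i)
    simp [hR, hQ]
  · rw [jForm_eq, Sum.elim_comp_inl, Sum.elim_comp_inr]
    exact sub_nonpos.2 h2

/-- On a strictly `j`-negative subspace the difference of the two components is injective. -/
lemma isUnit_toRows_sub {γ : Matrix (Fin p) (Fin p ⊕ Fin p) ℂ}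
    (hγ : γ * jMat p * γᴴ = 1) {T : Matrix (Fin p ⊕ Fin p) (Fin p) ℂ} (hT : IsJNonpos T) :
    IsUnit (((1 - jProj γ) * T).toRows₁ - ((1 - jProj γ) * T).toRows₂) := by
  set V := (1 - jProj γ) * T with hV
  refine mulVec_injective_iff_isUnit.1
    ((injective_iff_map_eq_zero (V.toRows₁ - V.toRows₂).mulVecLin).2 fun v hv => ?_)
  by_contra hne
  have h1 : V.toRows₁ *ᵥ v = V.toRows₂ *ᵥ v := by
    rw [← sub_eq_zero, ← sub_mulVec]; exact hv
  refine one_sub_jProj_mul_mulVec_ne_zero hγ hT hne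
    ((jForm_kernel hγ (jMat_one_sub_jProj_mulVec hγ T v)).2 ?_)
  rw [← hV, jForm_eq, show (V *ᵥ v) ∘ Sum.inl = (V *ᵥ v) ∘ Sum.inr from h1, sub_self]

lemma eventually_nhdsNE_of_codiscreteWithin {P : ℂ → Prop}
    (h : ∀ᶠ μ in codiscreteWithin lowerHalfPlane, P μ) : ∀ᶠ μ in 𝓝[≠] (-Complex.I), P μ := by
  have h1 := mem_codiscreteWithin_iff_forall_mem_nhdsNE.1 h (-Complex.I) (by simp [lowerHalfPlane])
  have h2 : lowerHalfPlane ∈ 𝓝[≠] (-Complex.I) :=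
    nhdsWithin_le_nhds ((isOpen_lt Complex.continuous_im continuous_const).mem_nhds
      (by simp))
  filter_upwards [h1, h2] with μ hμ hμ'
  rcases hμ with hμ | hμ
  · exact hμ
  · exact absurd hμ' hμ

lemma continuousAt_toRows₁ {Y : ℂ → Matrix (Fin p ⊕ Fin p) (Fin p) ℂ} {a : ℂ}
    (hY : ContinuousAt Y a) : ContinuousAt (fun z => (Y z).toRows₁) a :=
  continuousAt_pi.2 fun i => continuousAt_pi.1 hY (Sum.inl i)

lemma continuousAt_toRows₂ {Y : ℂ → Matrix (Fin p ⊕ Fin p) (Fin p) ℂ} {a : ℂ}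
    (hY : ContinuousAt Y a) : ContinuousAt (fun z => (Y z).toRows₂) a :=
  continuousAt_pi.2 fun i => continuousAt_pi.1 hY (Sum.inr i)

/-- Local form of the linear-fractional representation: `i φ` is the Cayley transform of the
quotient of the two components of a product of elementary factors. -/
lemma IsWeylFunction.exists_tailProd {N : ℕ} {C : ℕ → BlockMat p}
    {φ : ℂ → Matrix (Fin p) (Fin p) ℂ} (hφ : IsWeylFunction C N φ)
    {γ : ℕ → Matrix (Fin p) (Fin p ⊕ Fin p) ℂ} (hγ : ∀ k, γ k * jMat p * (γ k)ᴴ = 1)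
    (hC : ∀ k ≤ N, C k = ((2 : ℂ) • jProj (γ k) - 1) * jMat p) :
    ∃ X : ℂ → Matrix (Fin p ⊕ Fin p) (Fin p) ℂ, ContinuousAt X 0 ∧ IsJNonpos (X 0) ∧
      ∃ D : ℂ → Matrix (Fin p) (Fin p) ℂ, ContinuousAt D 0 ∧ IsUnit (D 0) ∧
        (∀ᶠ z in 𝓝 0, IsUnit (D z)) ∧
        ∀ᶠ z in 𝓝[≠] 0, tailProd γ X (N + 1) 0 z =
          fromRows (1 - Complex.I • φ (diskToHalfPlane z))
            (-(1 + Complex.I • φ (diskToHalfPlane z))) * D z := by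
  obtain ⟨-, R, Q, hRQ, hφ⟩ := hφ
  set X : ℂ → Matrix (Fin p ⊕ Fin p) (Fin p) ℂ :=
    fun z => fromRows (R (diskToHalfPlane z)) (Q (diskToHalfPlane z)) with hXdef
  have hXc : ContinuousAt X 0 := by
    have hc {f : ℂ → ℂ} (hf : AnalyticAt ℂ f (-Complex.I)) :
        ContinuousAt (fun z => f (diskToHalfPlane z)) 0 :=
      ContinuousAt.comp (g := f) (by rw [diskToHalfPlane_zero]; exact hf.continuousAt)
        analyticAt_diskToHalfPlane.continuousAt
    refine continuousAt_pi.2 ?_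
    rintro (i | i) <;> refine continuousAt_pi.2 fun k => ?_
    · exact hc (hRQ.analytic_R i k)
    · exact hc (hRQ.analytic_Q i k)
  have hX0 : IsJNonpos (X 0) := by
    rw [hXdef]
    simp only [diskToHalfPlane_zero]
    exact hRQ.ineq_at.isJNonpos
  set Y := tailProd γ X (N + 1) 0 with hY
  have hYc : ContinuousAt Y 0 := continuousAt_tailProd γ hXc _ _
  have hDc : ContinuousAt (fun z => (Y z).toRows₁ - (Y z).toRows₂) 0 :=
    (continuousAt_toRows₁ hYc).sub (continuousAt_toRows₂ hYc)
  -- `X 0` is only nonpositive; the outermost projection, present since there are `N + 1 ≥ 1`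
  -- factors, makes the space strictly negative.
  have hD0 : IsUnit ((Y 0).toRows₁ - (Y 0).toRows₂) := by
    simp only [hY, tailProd, diracFactor_zero]
    exact isUnit_toRows_sub (hγ 0) (isJNonpos_tailProd hγ hX0 N (0 + 1))
  have hDu : ∀ᶠ z in 𝓝 0, IsUnit ((Y z).toRows₁ - (Y z).toRows₂) := by
    have hdet : ContinuousAt (fun z => ((Y z).toRows₁ - (Y z).toRows₂).det) 0 :=
      ContinuousAt.comp (g := fun A : Matrix (Fin p) (Fin p) ℂ => A.det)
        continuous_id.matrix_det.continuousAt hDc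
    filter_upwards [hdet.eventually_ne ((isUnit_iff_isUnit_det _).1 hD0).ne_zero] with z hz
    exact (isUnit_iff_isUnit_det _).2 hz.isUnit
  -- Subtracting the two desired block rows leaves `2 D`, which forces this choice.
  refine ⟨X, hXc, hX0, fun z => (1 / 2 : ℂ) • ((Y z).toRows₁ - (Y z).toRows₂),
    hDc.fun_const_smul _, ?_, ?_, ?_⟩
  · exact hD0.smul (Units.mk0 (1 / 2 : ℂ) (by norm_num))
  · exact hDu.mono fun z hz => hz.smul (Units.mk0 (1 / 2 : ℂ) (by norm_num))
  filter_upwards [tendsto_diskToHalfPlane (eventually_nhdsNE_of_codiscreteWithin hφ),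
    hDu.filter_mono nhdsWithin_le_nhds, eventually_ne_one.filter_mono nhdsWithin_le_nhds]
    with z hz hu hz1
  rw [Set.mem_preimage, Set.mem_ofPred_eq, (toBlocks_mul_add _ _ _).1,
    (toBlocks_mul_add _ _ _).2] at hz
  have hA : mobiusCoeff C N (diskToHalfPlane z) * X z =
      (2 / (z + 1)) ^ (N + 1) • (KMat p * Y z) := by
    have := headProd_mul_tailProd γ X z (N + 1) 0
    rw [zero_add, headProd, Matrix.one_mul] at this
    rw [mobiusCoeff, fundSol_conjTranspose hC hz1.1 hz1.2 _ le_rfl, Matrix.mul_smul,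
      Matrix.smul_mul, Matrix.mul_assoc, ← this]
  have hs (c : ℂ) (A : Matrix (Fin p ⊕ Fin p) (Fin p) ℂ) :
      (c • A).toRows₁ = c • A.toRows₁ ∧ (c • A).toRows₂ = c • A.toRows₂ := ⟨rfl, rfl⟩
  have hr : ((1 / Real.sqrt 2 : ℝ) : ℂ) ≠ 0 := by
    rw [Complex.ofReal_ne_zero]; positivity
  have hc : (2 / (z + 1)) ^ (N + 1) * ((1 / Real.sqrt 2 : ℝ) : ℂ) ≠ 0 :=
    mul_ne_zero (pow_ne_zero _ (div_ne_zero two_ne_zero hz1.2)) hr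
  rw [show fromRows (R (diskToHalfPlane z)) (Q (diskToHalfPlane z)) = X z from rfl, hA,
    (hs _ _).1, (hs _ _).2, (KMat_mul_toRows _).1, (KMat_mul_toRows _).2, smul_smul,
    smul_smul] at hz
  generalize (2 / (z + 1)) ^ (N + 1) * ((1 / Real.sqrt 2 : ℝ) : ℂ) = c at hz hc
  -- The nonzero scalar `c` cancels in the Möbius quotient.
  have hφD : (Complex.I • φ (diskToHalfPlane z)) * ((Y z).toRows₁ - (Y z).toRows₂) =
      -((Y z).toRows₁ + (Y z).toRows₂) := by
    have hcu : IsUnit (c • ((Y z).toRows₁ - (Y z).toRows₂)) := hu.smul (Units.mk0 c hc)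
    refine smul_right_injective _ hc ?_
    simp only
    rw [← Matrix.mul_smul, hz, smul_smul, Complex.I_mul_I, Matrix.smul_mul,
      nonsing_inv_mul_cancel_right _ _ ((isUnit_iff_isUnit_det _).1 hcu), neg_smul, one_smul,
      smul_neg]
  rw [fromRows_mul, Matrix.mul_smul, Matrix.mul_smul, Matrix.sub_mul, Matrix.neg_mul,
    Matrix.add_mul, hφD, Matrix.one_mul]
  change Y z = _
  conv_lhs => rw [← fromRows_toRows (Y z)]
  congr 1 <;> module

/-! ### Taylor coefficients and conclusion -/

/-- Agreement of Taylor coefficients means agreement up to a multiple of a power of `z`. -/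
lemma exists_eq_add_pow_smul {φ₁ φ₂ : ℂ → Matrix (Fin p) (Fin p) ℂ} {N : ℕ}
    (h₁ : ∀ a b, DifferentiableOn ℂ (fun μ => φ₁ μ a b) lowerHalfPlane)
    (h₂ : ∀ a b, DifferentiableOn ℂ (fun μ => φ₂ μ a b) lowerHalfPlane)
    (hα : ∀ k ≤ N, taylorCoeff φ₁ k = taylorCoeff φ₂ k) :
    ∃ G : ℂ → Matrix (Fin p) (Fin p) ℂ, ContinuousAt G 0 ∧ ∀ᶠ z in 𝓝 0,
      Complex.I • φ₂ (diskToHalfPlane z) =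
        Complex.I • φ₁ (diskToHalfPlane z) + z ^ (N + 1) • G z := by
  have han {φ : ℂ → Matrix (Fin p) (Fin p) ℂ}
      (h : ∀ a b, DifferentiableOn ℂ (fun μ => φ μ a b) lowerHalfPlane) (a b : Fin p) :
      AnalyticAt ℂ (fun z => Complex.I * φ (diskToHalfPlane z) a b) 0 := by
    have hopen : IsOpen lowerHalfPlane := isOpen_lt Complex.continuous_im continuous_const
    have := (h a b).analyticAt (hopen.mem_nhds (x := diskToHalfPlane 0)
      (by simp [diskToHalfPlane_zero, lowerHalfPlane]))
    exact analyticAt_const.mul (this.comp analyticAt_diskToHalfPlane)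
  have key (a b : Fin p) : ∃ g : ℂ → ℂ, AnalyticAt ℂ g 0 ∧ ∀ᶠ z in 𝓝 0,
      Complex.I * φ₂ (diskToHalfPlane z) a b - Complex.I * φ₁ (diskToHalfPlane z) a b =
        z ^ (N + 1) * g z := by
    have hsub := (han h₂ a b).sub (han h₁ a b)
    obtain ⟨g, hg, hgz⟩ := (natCast_le_analyticOrderAt hsub (n := N + 1)).1 <|
      (natCast_le_analyticOrderAt_iff_iteratedDeriv_eq_zero hsub).2 fun i hi => by
        have hi' := congrFun (congrFun (hα i (by omega)) a) b
        simp only [taylorCoeff, of_apply] at hi'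
        rw [div_left_inj' (by exact_mod_cast i.factorial_ne_zero)] at hi'
        rw [iteratedDeriv_sub (han h₂ a b).contDiffAt (han h₁ a b).contDiffAt, sub_eq_zero]
        exact hi'.symm
    exact ⟨g, hg, by simpa using hgz⟩
  choose g hg hgz using key
  refine ⟨fun z => of fun a b => g a b z,
    continuousAt_pi.2 fun a => continuousAt_pi.2 fun b => (hg a b).continuousAt, ?_⟩
  have hall : ∀ᶠ z in 𝓝 (0 : ℂ), ∀ a b, Complex.I * φ₂ (diskToHalfPlane z) a b -
      Complex.I * φ₁ (diskToHalfPlane z) a b = z ^ (N + 1) * g a b z :=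
    eventually_all.2 fun a => eventually_all.2 fun b => hgz a b
  filter_upwards [hall] with z hz
  ext a b
  simpa using sub_eq_iff_eq_add'.1 (hz a b)

lemma potential_eq_of_taylorCoeff_eq {N N₁ N₂ : ℕ} {C₁ C₂ : ℕ → BlockMat p}
    (hC₁ : IsPotential N₁ C₁) (hC₂ : IsPotential N₂ C₂) {φ₁ φ₂ : ℂ → Matrix (Fin p) (Fin p) ℂ}
    (hφ₁ : IsWeylFunction C₁ N₁ φ₁) (hφ₂ : IsWeylFunction C₂ N₂ φ₂) (hN₁ : N ≤ N₁) (hN₂ : N ≤ N₂)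
    (hα : ∀ k ≤ N, taylorCoeff φ₁ k = taylorCoeff φ₂ k) {k : ℕ} (hk : k ≤ N) :
    C₁ k = C₂ k := by
  obtain ⟨γ, hγ, hCγ⟩ := hC₁.exists_jProj
  obtain ⟨δ, hδ, hCδ⟩ := hC₂.exists_jProj
  obtain ⟨X, hXc, hX, D, hDc, hD0, hDu, hXD⟩ := hφ₁.exists_tailProd hγ hCγ
  obtain ⟨Y, hYc, -, D', hDc', hD0', -, hYD⟩ := hφ₂.exists_tailProd hδ hCδ
  obtain ⟨G, hGc, hG⟩ := exists_eq_add_pow_smul hφ₁.1 hφ₂.1 hα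
  have hinv : ContinuousAt (fun z => (D z)⁻¹) 0 := by
    refine ContinuousAt.comp (g := Inv.inv) (continuousAt_matrix_inv _ ?_) hDc
    rw [Ring.inverse_eq_inv']
    exact continuousAt_inv₀ ((isUnit_iff_isUnit_det _).1 hD0).ne_zero
  have hrows : ContinuousAt (fun z => fromRows (-G z) (-G z)) 0 := by
    refine continuousAt_pi.2 ?_
    rintro (i | i) <;> exact continuousAt_pi.1 hGc.neg i
  -- Replacing `iφ₁` by `iφ₂` changes both block rows by `-z ^ (N + 1) G`. So `U = D⁻¹ D'` and `E =
  -- (-G; -G) D'`.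
  have hproj := jProj_eq_of_tailProd_eq hγ hδ hXc hYc hX
    (continuousAt_matrix_mul hinv hDc') ((isUnit_nonsing_inv_iff.2 hD0).mul hD0') (N + 1)
    (N₁ + 1) (N₂ + 1) 0 (by omega) (by omega) _ (continuousAt_matrix_mul hrows hDc') ?_ k
    (by omega)
  · rw [zero_add] at hproj
    rw [hCγ k (hk.trans hN₁), hCδ k (hk.trans hN₂), hproj]
  filter_upwards [hXD, hYD, hG.filter_mono nhdsWithin_le_nhds,
    hDu.filter_mono nhdsWithin_le_nhds] with z hx hy hg hu
  rw [hy, hx, hg, Matrix.mul_assoc,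
    mul_nonsing_inv_cancel_left _ _ ((isUnit_iff_isUnit_det _).1 hu), ← Matrix.smul_mul,
    ← Matrix.add_mul]
  congr 1
  ext (i | i) b <;> simp <;> ring

end

end DiscreteDirac

theorem mainTheorem5 (p N N₁ N₂ : ℕ)
    (C₁ C₂ : ℕ → DiscreteDirac.BlockMat p)
    (hC₁ : DiscreteDirac.IsPotential N₁ C₁)
    (hC₂ : DiscreteDirac.IsPotential N₂ C₂)
    (φ₁ φ₂ : ℂ → Matrix (Fin p) (Fin p) ℂ)
    (hφ₁ : DiscreteDirac.IsWeylFunction C₁ N₁ φ₁)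
    (hφ₂ : DiscreteDirac.IsWeylFunction C₂ N₂ φ₂)
    (hN : N ≤ min N₁ N₂)
    (hα : ∀ k ≤ N, DiscreteDirac.taylorCoeff φ₁ k = DiscreteDirac.taylorCoeff φ₂ k) :
    ∀ k ≤ N, C₁ k = C₂ k := fun _ hk =>
  DiscreteDirac.potential_eq_of_taylorCoeff_eq hC₁ hC₂ hφ₁ hφ₂ (hN.trans (min_le_left _ _))
    (hN.trans (min_le_right _ _)) hα hk
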